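/- **Setting.** Let $n\ge 2$ and let $\Delta$ be a finite, non-empty simplicial complex embedded in $\mathbb{R}^n$, with $\Delta_k$ its set of $k$-faces and $|\Delta|$ its underlying set. Let $\Delta_{n-1}^\circ$ be the set of interior $(n-1)$-faces, i.e. those contained in two different $n$-faces. Assume that $\Delta$ is *pure* (all maximal faces have dimension $n$) and *hereditary*: whenever $\sigma,\sigma'\in\Delta_n$ meet in a face $\beta$ of $\Delta$, there is a sequence $\sigma=\sigma_0,\dots,\sigma_m=\sigma'$ in $\Delta_n$ with $\beta\subseteq\sigma_j$ for all $j$ and $\sigma_{j-1}\cap\sigma_j\in\Delta_{n-1}^\circ$ for $j=1,\dots,m$. Fix $0\le i\le n-2$ and non-negative integers $d$, $\boldsymbol r=(r_\tau)_{\tau\in\Delta_{n-1}^\circ}$, $\boldsymbol s=(s_\beta)_{\beta\in\Delta_i}$. If $d=0$, assume also that $|\Delta|$ is connected. **Splines on $\Delta$.** $\mathcal S^{\boldsymbol r,\boldsymbol s}_d(\Delta)$ is the real vector space of continuous functions $f:|\Delta|\to\mathbb{R}$ such that 1. $f|_\sigma$ is a polynomial of total degree at most $d$ for each $\sigma\in\Delta_n$;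 2. for each $\tau\in\Delta_{n-1}^\circ$, $f$ is $r_\tau$ times continuously differentiable on the star of $\tau$ (the union of the simplices of $\Delta$ having $\tau$ as a face); 3. for each $\beta\in\Delta_i$, the polynomials $f|_\sigma$, for all $\sigma\in\Delta_n$ with $\beta\subseteq\sigma$, have common derivatives up to order $s_\beta$ at all points of $\beta$. **The cone.** For a simplex $\beta\subset\mathbb{R}^n$ let $\hat\beta\subset\mathbb{R}^{n+1}$ be the convex hull of the origin and $\{1\}\times\beta$, where $\mathbb{R}^{n+1}$ has coordinates $x_0,x_1,\dots,x_n$. The cone $\hat\Delta$ over $\Delta$ is the simplicial complex consisting of the simplices $\hat\beta$ ($\beta\in\Delta$) and their faces, that is, together with the origin and the simplices $\{1\}\times\beta$. Its interior $n$-faces are the $\hat\tau$ with $\tau\in\Delta_{n-1}^\circ$. $\mathcal S^{\boldsymbol r,\boldsymbol s}(\hat\Delta)_d$ is the real vector space of continuous functions $F:|\hat\Delta|\to\mathbb{R}$ such that 1. $F|_{\hat\sigma}$ is a homogeneous polynomial of degree $d$ (or zero) for each $\sigma\in\Delta_n$; 2. for each $\tau\in\Delta_{n-1}^\circ$, $F$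 is $r_\tau$ times continuously differentiable on the star of $\hat\tau$ in $\hat\Delta$; 3. for each $\beta\in\Delta_i$, the polynomials $F|_{\hat\sigma}$, for all $\sigma\in\Delta_n$ with $\beta\subseteq\sigma$, have common derivatives up to order $s_\beta$ at all points of $\hat\beta$. **Proposition.** There is an isomorphism of real vector spaces $$\varphi:\ \mathcal S^{\boldsymbol r,\boldsymbol s}(\hat\Delta)_d\ \xrightarrow{\ \cong\ }\ \mathcal S^{\boldsymbol r,\boldsymbol s}_d(\Delta)$$ given by dehomogenization of the pieces: for every $\sigma\in\Delta_n$, if $F|_{\hat\sigma}$ is the polynomial $P(x_0,x_1,\dots,x_n)$, then $\varphi(F)|_\sigma$ is the polynomial $P(1,x_1,\dots,x_n)$. -/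

import Mathlib

/-!
Conventions: a simplex of a geometric simplicial complex is stored as its finite set of vertices;
the simplex itself is `convexHull ℝ σ`, and its dimension is `σ.card - 1`.
-/

noncomputable section

namespace SuperSpline

open Geometry MvPolynomial

/-! ### Faces, purity, the hereditary condition -/

section Complex

variable {m : ℕ}

/-- The set of `k`-dimensional faces of a complex `K`. -/
def facesDim (K : SimplicialComplex ℝ (Fin m → ℝ)) (k : ℕ) : Set (Finset (Fin m → ℝ)) :=
  {σ | σ ∈ K.faces ∧ σ.card = k + 1}

/-- The interior codimension-one faces of a complex `K` in `ℝ^m`: the `(m-1)`-faces that lie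
in two different `m`-faces. -/
def interiorFacets (K : SimplicialComplex ℝ (Fin m → ℝ)) : Set (Finset (Fin m → ℝ)) :=
  {τ | τ ∈ K.faces ∧ τ.card = m ∧
    ∃ σ ∈ facesDim K m, ∃ σ' ∈ facesDim K m, σ ≠ σ' ∧ τ ⊆ σ ∧ τ ⊆ σ'}

/-- All maximal faces have the dimension `m` of the ambient space. -/
def IsPure (K : SimplicialComplex ℝ (Fin m → ℝ)) : Prop :=
  ∀ σ ∈ K.facets, σ.card = m + 1

/-- Whenever two `m`-faces `σ`, `σ'` meet in a face `β`, there is a sequence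
`σ = c 0, c 1, …, c N = σ'` of `m`-faces containing `β` in which consecutive members
meet in an interior `(m-1)`-face. -/
def IsHereditary (K : SimplicialComplex ℝ (Fin m → ℝ)) : Prop :=
  ∀ σ ∈ facesDim K m, ∀ σ' ∈ facesDim K m, ∀ β ∈ K.faces,
    (σ : Set (Fin m → ℝ)) ∩ σ' = β →
      ∃ (N : ℕ) (c : ℕ → Finset (Fin m → ℝ)), c 0 = σ ∧ c N = σ' ∧
        (∀ j ≤ N, c j ∈ facesDim K m ∧ β ⊆ c j) ∧
        ∀ j < N, ∃ τ ∈ interiorFacets K, (c j : Set (Fin m → ℝ)) ∩ c (j + 1) = τ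

/-- The underlying set of the star of `β` in `K`: the union of all simplices of `K` having `β`
as a face. -/
def starSpace (K : SimplicialComplex ℝ (Fin m → ℝ)) (β : Finset (Fin m → ℝ)) :
    Set (Fin m → ℝ) :=
  ⋃ σ ∈ {σ | σ ∈ K.faces ∧ β ⊆ σ}, convexHull ℝ (σ : Set (Fin m → ℝ))

/-! ### Splines -/

/-- Extension by zero of a function on `|K|`; only its values on `|K|` are ever used. -/
def extendZero (K : SimplicialComplex ℝ (Fin m → ℝ)) (f : K.space → ℝ) : (Fin m → ℝ) → ℝ :=
  Function.extend Subtype.val f 0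

/-- The restriction of `f` to the simplex `σ` is the polynomial `p`. -/
def IsPiece {K : SimplicialComplex ℝ (Fin m → ℝ)} (f : K.space → ℝ)
    (σ : Finset (Fin m → ℝ)) (p : MvPolynomial (Fin m) ℝ) : Prop :=
  ∀ x : K.space, (x : Fin m → ℝ) ∈ convexHull ℝ (σ : Set (Fin m → ℝ)) → f x = eval x.1 p

/-- The polynomials `p` and `q` have the same derivatives up to order `k` at all points of the
simplex `β`. -/
def DerivsAgreeOn (k : ℕ) (β : Finset (Fin m → ℝ)) (p q : MvPolynomial (Fin m) ℝ) : Prop :=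
  ∀ j ≤ k, ∀ x ∈ convexHull ℝ (β : Set (Fin m → ℝ)),
    iteratedFDeriv ℝ j (fun y : Fin m → ℝ => eval y p) x =
      iteratedFDeriv ℝ j (fun y : Fin m → ℝ => eval y q) x

/-- `f` is a superspline on `K` with pieces in the space `D` of polynomials:
* `f` is continuous on `|K|`;
* `f` is `C^{r τ}` on the star of each interior codimension-one face `τ`;
* the restriction of `f` to each `m`-face `σ` is a polynomial `P σ ∈ D` (unique, as `σ` has
  non-empty interior), and for each `β ∈ B` the polynomials `P σ` with `β ⊆ σ` have common
  derivatives up to order `s β` on `β`. -/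
structure IsSuperspline (K : SimplicialComplex ℝ (Fin m → ℝ))
    (D : Submodule ℝ (MvPolynomial (Fin m) ℝ)) (r : Finset (Fin m → ℝ) → ℕ)
    (B : Set (Finset (Fin m → ℝ))) (s : Finset (Fin m → ℝ) → ℕ) (f : K.space → ℝ) : Prop where
  continuous : Continuous f
  smooth : ∀ τ ∈ interiorFacets K, ContDiffOn ℝ (r τ) (extendZero K f) (starSpace K τ)
  pieces : ∃ P : Finset (Fin m → ℝ) → MvPolynomial (Fin m) ℝ,
    (∀ σ ∈ facesDim K m, P σ ∈ D ∧ IsPiece f σ (P σ)) ∧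
    ∀ β ∈ B, ∀ σ ∈ facesDim K m, ∀ σ' ∈ facesDim K m, β ⊆ σ → β ⊆ σ' →
      DerivsAgreeOn (s β) β (P σ) (P σ')

theorem extendZero_add (K : SimplicialComplex ℝ (Fin m → ℝ)) (f g : K.space → ℝ) :
    extendZero K (f + g) = extendZero K f + extendZero K g := by
  unfold extendZero
  rw [← Function.extend_add, add_zero]

theorem extendZero_smul (K : SimplicialComplex ℝ (Fin m → ℝ)) (c : ℝ) (f : K.space → ℝ) :
    extendZero K (c • f) = c • extendZero K f := by
  unfold extendZero
  rw [← Function.extend_smul, smul_zero]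

theorem contDiff_eval (p : MvPolynomial (Fin m) ℝ) (k : WithTop ℕ∞) :
    ContDiff ℝ k (fun y : Fin m → ℝ => eval y p) := by
  induction p using MvPolynomial.induction_on with
  | C a => simpa using contDiff_const
  | add p q hp hq => simpa using hp.add hq
  | mul_X p i hp => simpa using hp.mul (contDiff_apply ℝ ℝ i)

theorem DerivsAgreeOn.add {k : ℕ} {β : Finset (Fin m → ℝ)} {p q p' q' : MvPolynomial (Fin m) ℝ}
    (h : DerivsAgreeOn k β p q) (h' : DerivsAgreeOn k β p' q') :
    DerivsAgreeOn k β (p + p') (q + q') := by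
  intro j hj x hx
  have key : ∀ a b : MvPolynomial (Fin m) ℝ,
      iteratedFDeriv ℝ j (fun y : Fin m → ℝ => eval y (a + b)) x =
        iteratedFDeriv ℝ j (fun y : Fin m → ℝ => eval y a) x +
          iteratedFDeriv ℝ j (fun y : Fin m → ℝ => eval y b) x := by
    intro a b
    rw [← iteratedFDeriv_add_apply (contDiff_eval a _).contDiffAt (contDiff_eval b _).contDiffAt]
    congr 1
    ext y
    simp
  rw [key, key, h j hj x hx, h' j hj x hx]

theorem DerivsAgreeOn.smul {k : ℕ} {β : Finset (Fin m → ℝ)} {p q : MvPolynomial (Fin m) ℝ}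
    (c : ℝ) (h : DerivsAgreeOn k β p q) : DerivsAgreeOn k β (c • p) (c • q) := by
  intro j hj x hx
  have key : ∀ a : MvPolynomial (Fin m) ℝ,
      iteratedFDeriv ℝ j (fun y : Fin m → ℝ => eval y (c • a)) x =
        c • iteratedFDeriv ℝ j (fun y : Fin m → ℝ => eval y a) x := by
    intro a
    rw [← iteratedFDeriv_const_smul_apply (contDiff_eval a _).contDiffAt]
    congr 1
    ext y
    simp [smul_eval]
  rw [key, key, h j hj x hx]

/-- The real vector space of supersplines on `K` with pieces in `D`, smoothness `r` across the
interior codimension-one faces and supersmoothness `s` at the faces in `B`. -/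
def supersplines (K : SimplicialComplex ℝ (Fin m → ℝ))
    (D : Submodule ℝ (MvPolynomial (Fin m) ℝ)) (r : Finset (Fin m → ℝ) → ℕ)
    (B : Set (Finset (Fin m → ℝ))) (s : Finset (Fin m → ℝ) → ℕ) :
    Submodule ℝ (K.space → ℝ) where
  carrier := {f | IsSuperspline K D r B s f}
  zero_mem' := by
    refine ⟨continuous_zero, fun τ _ => ?_, fun _ => 0, fun σ _ => ⟨D.zero_mem, ?_⟩, ?_⟩
    · have : extendZero K 0 = 0 := by simpa using extendZero_smul K 0 0
      rw [this]
      exact contDiff_zero_fun.contDiffOn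
    · intro x _
      simp
    · intro β _ σ _ σ' _ _ _ j _ x _
      rfl
  add_mem' := by
    rintro f g ⟨hf, hf', P, hP, hP'⟩ ⟨hg, hg', Q, hQ, hQ'⟩
    refine ⟨hf.add hg, fun τ hτ => ?_, P + Q, fun σ hσ => ⟨?_, fun x hx => ?_⟩, ?_⟩
    · rw [extendZero_add]
      exact (hf' τ hτ).add (hg' τ hτ)
    · exact D.add_mem (hP σ hσ).1 (hQ σ hσ).1
    · simp [(hP σ hσ).2 x hx, (hQ σ hσ).2 x hx]
    · intro β hβ σ hσ σ' hσ' h h'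
      exact (hP' β hβ σ hσ σ' hσ' h h').add (hQ' β hβ σ hσ σ' hσ' h h')
  smul_mem' := by
    rintro c f ⟨hf, hf', P, hP, hP'⟩
    refine ⟨hf.const_smul c, fun τ hτ => ?_, c • P, fun σ hσ => ⟨?_, fun x hx => ?_⟩, ?_⟩
    · rw [extendZero_smul]
      exact contDiffOn_const.smul (hf' τ hτ)
    · exact D.smul_mem c (hP σ hσ).1
    · simp [(hP σ hσ).2 x hx, smul_eval]
    · intro β hβ σ hσ σ' hσ' h h'
      exact (hP' β hβ σ hσ σ' hσ' h h').smul c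

/-- Supersplines all of whose pieces have total degree at most `d`. -/
def supersplinesLE (K : SimplicialComplex ℝ (Fin m → ℝ)) (r : Finset (Fin m → ℝ) → ℕ)
    (B : Set (Finset (Fin m → ℝ))) (s : Finset (Fin m → ℝ) → ℕ) (d : ℕ) :
    Submodule ℝ (K.space → ℝ) :=
  supersplines K (restrictTotalDegree (Fin m) ℝ d) r B s

/-- Supersplines all of whose pieces are homogeneous of degree `d` (or zero). -/
def supersplinesHomogeneous (K : SimplicialComplex ℝ (Fin m → ℝ)) (r : Finset (Fin m → ℝ) → ℕ)
    (B : Set (Finset (Fin m → ℝ))) (s : Finset (Fin m → ℝ) → ℕ) (d : ℕ) :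
    Submodule ℝ (K.space → ℝ) :=
  supersplines K (homogeneousSubmodule (Fin m) ℝ d) r B s

end Complex

/-! ### The cone over a complex -/

section Cone

variable {n : ℕ}

/-- The embedding `(x₁, …, xₙ) ↦ (1, x₁, …, xₙ)` of `ℝ^n` in `ℝ^(n+1)`. -/
def embed : (Fin n → ℝ) ↪ (Fin (n + 1) → ℝ) where
  toFun x := Fin.cons 1 x
  inj' x y h := by
    ext i
    simpa using congrFun h i.succ

theorem embed_apply_zero (x : Fin n → ℝ) : embed x 0 = 1 := rfl

theorem embed_ne_zero (x : Fin n → ℝ) : embed x ≠ 0 := fun h => by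
  simpa [embed_apply_zero] using congrFun h 0

/-- The embedding as an affine map. -/
def embedAffine : (Fin n → ℝ) →ᵃ[ℝ] (Fin (n + 1) → ℝ) where
  toFun := embed
  linear :=
    { toFun := fun x => Fin.cons 0 x
      map_add' := fun x y => by
        ext i
        refine Fin.cases ?_ (fun i => ?_) i <;> simp
      map_smul' := fun c x => by
        ext i
        refine Fin.cases ?_ (fun i => ?_) i <;> simp }
  map_vadd' x v := by
    ext i
    change (Fin.cons 1 (v + x) : Fin (n + 1) → ℝ) i =
      (Fin.cons 0 v + Fin.cons 1 x : Fin (n + 1) → ℝ) i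
    refine Fin.cases ?_ (fun i => ?_) i <;> simp

theorem convexHull_embed (b : Set (Fin n → ℝ)) :
    convexHull ℝ (embed '' b) = embed '' convexHull ℝ b :=
  ((embedAffine (n := n)).image_convexHull b).symm

theorem zero_notMem_map_embed (β : Finset (Fin n → ℝ)) :
    (0 : Fin (n + 1) → ℝ) ∉ β.map embed := by
  intro h
  obtain ⟨x, -, hx⟩ := Finset.mem_map.1 h
  exact embed_ne_zero x hx

/-- The (vertex set of the) cone over the simplex `β`: the origin together with the embedded
vertices of `β`. -/
def coneFace (β : Finset (Fin n → ℝ)) : Finset (Fin (n + 1) → ℝ) :=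
  Finset.cons 0 (β.map embed) (zero_notMem_map_embed β)

/-- The points of `ℝ^n` whose images under the embedding belong to `F`. -/
def base (F : Finset (Fin (n + 1) → ℝ)) : Finset (Fin n → ℝ) :=
  F.preimage embed embed.injective.injOn

theorem mem_base {F : Finset (Fin (n + 1) → ℝ)} {x : Fin n → ℝ} : x ∈ base F ↔ embed x ∈ F := by
  simp [base]

theorem base_coneFace (β : Finset (Fin n → ℝ)) : base (coneFace β) = β := by
  ext x
  simp [base, coneFace, embed_ne_zero]

theorem eq_zero_or_mem_base {F : Finset (Fin (n + 1) → ℝ)} {β : Finset (Fin n → ℝ)}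
    (hF : F ⊆ coneFace β) {x : Fin (n + 1) → ℝ} (hx : x ∈ F) :
    x = 0 ∨ ∃ y ∈ base F, embed y = x := by
  rcases Finset.mem_cons.1 (hF hx) with h | h
  · exact Or.inl h
  · obtain ⟨y, -, rfl⟩ := Finset.mem_map.1 h
    exact Or.inr ⟨y, mem_base.2 hx, rfl⟩

theorem base_subset {F : Finset (Fin (n + 1) → ℝ)} {β : Finset (Fin n → ℝ)}
    (hF : F ⊆ coneFace β) : base F ⊆ β := by
  intro x hx
  rw [← base_coneFace β]
  exact mem_base.2 (hF (mem_base.1 hx))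

/-- Points of the convex hull of vertices of a cone. -/
theorem exists_of_mem_convexHull {F : Finset (Fin (n + 1) → ℝ)} {β : Finset (Fin n → ℝ)}
    (hF : F ⊆ coneFace β) {x : Fin (n + 1) → ℝ}
    (hx : x ∈ convexHull ℝ (F : Set (Fin (n + 1) → ℝ))) :
    (x = 0 ∧ 0 ∈ F) ∨ ∃ y ∈ convexHull ℝ (base F : Set (Fin n → ℝ)), ∃ t : ℝ,
      0 < t ∧ t ≤ 1 ∧ (t = 1 ∨ 0 ∈ F) ∧ x = t • embed y := by
  by_cases h0 : 0 ∈ F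
  · have hF' : (F : Set (Fin (n + 1) → ℝ)) = insert 0 (embed '' (base F : Set (Fin n → ℝ))) := by
      ext z
      constructor
      · intro hz
        rcases eq_zero_or_mem_base hF hz with h | ⟨y, hy, rfl⟩
        · exact Or.inl h
        · exact Or.inr ⟨y, hy, rfl⟩
      · rintro (rfl | ⟨y, hy, rfl⟩)
        · exact h0
        · exact mem_base.1 hy
    rcases (base F).eq_empty_or_nonempty with hb | hb
    · rw [hF', hb] at hx
      left
      simpa [h0] using hx
    · rw [hF', convexHull_insert (Set.Nonempty.image _ hb), convexHull_embed, mem_convexJoin] at hx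
      obtain ⟨a, ha, _, ⟨y, hy, rfl⟩, u, t, hu, ht, hut, rfl⟩ := hx
      rw [Set.mem_singleton_iff] at ha
      subst ha
      rcases ht.eq_or_lt with rfl | ht
      · left
        simp [h0]
      · exact Or.inr ⟨y, hy, t, ht, by linarith, Or.inr h0, by simp⟩
  · have hF' : (F : Set (Fin (n + 1) → ℝ)) = embed '' (base F : Set (Fin n → ℝ)) := by
      ext z
      constructor
      · intro hz
        rcases eq_zero_or_mem_base hF hz with rfl | ⟨y, hy, rfl⟩
        · exact absurd hz h0
        · exact ⟨y, hy, rfl⟩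
      · rintro ⟨y, hy, rfl⟩
        exact mem_base.1 hy
    rw [hF', convexHull_embed] at hx
    obtain ⟨y, hy, rfl⟩ := hx
    exact Or.inr ⟨y, hy, 1, one_pos, le_rfl, Or.inl rfl, by simp⟩

theorem affineIndependent_coneFace {β : Finset (Fin n → ℝ)}
    (h : AffineIndependent ℝ ((↑) : β → Fin n → ℝ)) :
    AffineIndependent ℝ ((↑) : coneFace β → Fin (n + 1) → ℝ) := by
  let i : coneFace β := ⟨0, Finset.mem_cons_self _ _⟩
  have hne : ∀ x : coneFace β, x ≠ i → ∃ y ∈ β, embed y = x := by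
    rintro ⟨x, hx⟩ hxi
    rcases Finset.mem_cons.1 hx with rfl | hx
    · exact absurd rfl hxi
    · simpa using hx
  refine AffineIndependent.affineIndependent_of_notMem_span (i := i) ?_ ?_
  · have h1 : AffineIndependent ℝ (embedAffine ∘ ((↑) : β → Fin n → ℝ)) :=
      h.map' embedAffine embed.injective
    have h2 := h1.range
    have h3 : ∀ x : {y // y ≠ i},
        (x.1 : Fin (n + 1) → ℝ) ∈ Set.range (embedAffine ∘ ((↑) : β → Fin n → ℝ)) := by
      intro x
      obtain ⟨y, hy, hyx⟩ := hne x.1 x.2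
      exact ⟨⟨y, hy⟩, hyx⟩
    exact h2.comp_embedding ⟨fun x => ⟨x.1.1, h3 x⟩, fun x y hxy =>
      Subtype.ext (Subtype.ext (Subtype.mk.inj hxy))⟩
  · intro hmem
    have hle : affineSpan ℝ (((↑) : coneFace β → Fin (n + 1) → ℝ) '' {x | x ≠ i}) ≤
        (⊤ : AffineSubspace ℝ (Fin n → ℝ)).map embedAffine := by
      rw [affineSpan_le]
      rintro _ ⟨x, hx, rfl⟩
      obtain ⟨y, -, hyx⟩ := hne x hx
      exact ⟨y, trivial, hyx⟩
    obtain ⟨y, -, hy⟩ := hle hmem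
    exact embed_ne_zero y hy

/-- The cone over the complex `K`: its faces are the cones over the faces of `K`, the origin,
and (so that faces of faces are faces) the embedded faces of `K`; that is, all non-empty subsets
of the vertex sets of the cones and of `{0}`, the cone over the empty face. -/
def cone (K : SimplicialComplex ℝ (Fin n → ℝ)) : SimplicialComplex ℝ (Fin (n + 1) → ℝ) where
  faces := {F | F.Nonempty ∧ ∃ β ∈ insert ∅ K.faces, F ⊆ coneFace β}
  isRelLowerSet_faces := by
    rintro F ⟨hF, β, hβ, hFβ⟩
    exact ⟨hF, fun G hGF hG => ⟨hG, β, hβ, hGF.trans hFβ⟩⟩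
  indep := by
    rintro F ⟨-, β, hβ, hFβ⟩
    have hβ' : AffineIndependent ℝ ((↑) : β → Fin n → ℝ) := by
      rcases hβ with rfl | hβ
      · exact affineIndependent_of_subsingleton ℝ _
      · exact K.indep hβ
    exact AffineIndependent.mono (t := (coneFace β : Set (Fin (n + 1) → ℝ)))
      (affineIndependent_coneFace hβ') (by exact_mod_cast hFβ)
  inter_subset_convexHull := by
    rintro F G ⟨-, β, hβ, hF⟩ ⟨-, γ, hγ, hG⟩ x ⟨hxF, hxG⟩
    rcases exists_of_mem_convexHull hF hxF with ⟨rfl, h0⟩ | ⟨y, hy, t, ht, ht1, htF, rfl⟩ <;>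
      rcases exists_of_mem_convexHull hG hxG with ⟨h0', h0G⟩ | ⟨y', hy', t', ht', -, htG, hyy⟩
    · exact subset_convexHull ℝ _ ⟨h0, h0G⟩
    · have := congrFun hyy 0
      simp [embed_apply_zero] at this
      exact absurd this ht'.ne
    · have := congrFun h0' 0
      simp [embed_apply_zero] at this
      exact absurd this ht.ne'
    · have htt : t = t' := by simpa [embed_apply_zero] using congrFun hyy 0
      subst htt
      have hyy' : y = y' := embed.injective (smul_right_injective _ ht.ne' hyy)
      subst hyy'
      have hbF : base F ∈ K.faces := by
        have hne : (base F).Nonempty := by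
          simpa using convexHull_nonempty_iff.1 ⟨y, hy⟩
        rcases hβ with rfl | hβ
        · exact absurd (Finset.subset_empty.1 (base_subset hF)) hne.ne_empty
        · exact K.down_closed hβ (base_subset hF) hne
      have hbG : base G ∈ K.faces := by
        have hne : (base G).Nonempty := by
          simpa using convexHull_nonempty_iff.1 ⟨y, hy'⟩
        rcases hγ with rfl | hγ
        · exact absurd (Finset.subset_empty.1 (base_subset hG)) hne.ne_empty
        · exact K.down_closed hγ (base_subset hG) hne
      have hyb := K.inter_subset_convexHull hbF hbG ⟨hy, hy'⟩
      have hey : embed y ∈ convexHull ℝ (F ∩ G : Set (Fin (n + 1) → ℝ)) := by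
        have : embed y ∈ convexHull ℝ (embed '' (base F ∩ base G : Set (Fin n → ℝ))) := by
          rw [convexHull_embed]
          exact ⟨y, hyb, rfl⟩
        refine convexHull_mono ?_ this
        rintro _ ⟨z, ⟨hz, hz'⟩, rfl⟩
        exact ⟨mem_base.1 hz, mem_base.1 hz'⟩
      rcases htF with rfl | h0F
      · simpa using hey
      rcases htG with rfl | h0G
      · simpa using hey
      have h0 : (0 : Fin (n + 1) → ℝ) ∈ convexHull ℝ (F ∩ G : Set (Fin (n + 1) → ℝ)) :=
        subset_convexHull ℝ _ ⟨h0F, h0G⟩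
      have := (convex_convexHull ℝ _).add_smul_mem h0 (by simpa using hey) ⟨ht.le, ht1⟩
      simpa using this

/-- Orders of smoothness on the faces of the cone: the cone over `β` gets the order of `β`. -/
def coneOrder (r : Finset (Fin n → ℝ) → ℕ) (F : Finset (Fin (n + 1) → ℝ)) : ℕ :=
  r (base F)

theorem coneOrder_coneFace (r : Finset (Fin n → ℝ) → ℕ) (β : Finset (Fin n → ℝ)) :
    coneOrder r (coneFace β) = r β := by
  rw [coneOrder, base_coneFace]

/-- Dehomogenization: the substitution `x₀ = 1`. -/
def dehomogenize :
    MvPolynomial (Fin (n + 1)) ℝ →ₐ[ℝ] MvPolynomial (Fin n) ℝ :=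
  aeval (Fin.cons 1 X)

end Cone

end SuperSpline

end

/-! A function that is homogeneous of degree `d` on each cone satisfies `F (t • embed y) = t ^ d * F
(embed y)`, so it is determined by its restriction to the hyperplane `x₀ = 1`. This restriction,
`restrictCone`, dehomogenizes the pieces and is the isomorphism. In the other direction `f` extends
by `t • embed y ↦ t ^ d * f y`, and the pieces of the extension are the homogenizations of those of
`f`. Off the apex a point determines `t` and `y`, so these pieces glue. At the apex they all vanish
if `d > 0`; if `d = 0` they are constants, equal because `|Δ|` is connected
(`eq_of_pieces_totalDegree_zero`).

It remains to see that the extension is smooth enough. By purity, the star of a codimension-one face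
`τ` is a finite union of full-dimensional simplices, and being `C^k` on it amounts to agreement of
the `k`-jets of the pieces along `τ` (`derivsAgreeOn_of_contDiffOn`, `contDiffOn_of_derivsAgreeOn`).
Smoothness and supersmoothness thus both become statements about jets. Jets lift to the cone by
`DerivsAgreeOn.homogenize`: off the apex the homogenization is `x₀ ^ d` times the pullback of the
polynomial under radial projection, and the apex is a limit of such points. Every interior facet of
the cone is the cone over an interior facet of `Δ` (`exists_of_mem_interiorFacets_cone`), so no
further conditions arise. -/

noncomputable section
namespace SuperSpline
open Geometry MvPolynomial

/-! ### Taylor series: gluing and transport -/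

section Jets

variable {E F G : Type*} [NormedAddCommGroup E] [NormedSpace ℝ E] [NormedAddCommGroup F]
  [NormedSpace ℝ F] [NormedAddCommGroup G] [NormedSpace ℝ G]

/-- The derivatives of `g ∘ f` at `x` up to order `k` depend only on those of `g` at `f x`. -/
theorem iteratedFDeriv_comp_congr {g h : F → G} {f : E → F} {x : E} {k : ℕ}
    (hg : ContDiffAt ℝ k g (f x)) (hh : ContDiffAt ℝ k h (f x)) (hf : ContDiffAt ℝ k f x)
    (H : ∀ j ≤ k, iteratedFDeriv ℝ j g (f x) = iteratedFDeriv ℝ j h (f x)) {j : ℕ} (hj : j ≤ k) :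
    iteratedFDeriv ℝ j (g ∘ f) x = iteratedFDeriv ℝ j (h ∘ f) x := by
  have hj' : (j : WithTop ℕ∞) ≤ k := by exact_mod_cast hj
  -- Faà di Bruno: each summand involves the outer function only through its derivative of order
  -- `c.length ≤ j`.
  rw [iteratedFDeriv_comp hg hf hj', iteratedFDeriv_comp hh hf hj']
  refine Finset.sum_congr rfl fun c _ => ?_
  have := H c.length (c.length_le.trans hj)
  ext v
  simp [FormalMultilinearSeries.compAlongOrderedFinpartition, ftaylorSeries, this]

/-- A multiple of a function whose derivatives up to order `k` vanish has the same property. -/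
theorem iteratedFDeriv_mul_eq_zero {a h : E → ℝ} {x : E} {k : ℕ}
    (ha : ContDiff ℝ k a) (hh : ContDiffAt ℝ k h x)
    (H : ∀ j ≤ k, iteratedFDeriv ℝ j h x = 0) {j : ℕ} (hj : j ≤ k) :
    iteratedFDeriv ℝ j (fun y => a y * h y) x = 0 := by
  obtain ⟨u, hu, hxu, hu'⟩ : ∃ u, IsOpen u ∧ x ∈ u ∧ ContDiffOn ℝ k h u := by
    obtain ⟨u, hu, h'⟩ := hh.contDiffOn le_rfl (by simp)
    obtain ⟨v, hv, hvo, hxv⟩ := mem_nhds_iff.1 (by simpa using hu)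
    exact ⟨v, hvo, hxv, h'.mono hv⟩
  have hj' : (j : WithTop ℕ∞) ≤ k := by exact_mod_cast hj
  -- In the Leibniz bound every summand carries a factor `‖iteratedFDeriv ℝ (j - i) h x‖ = 0`.
  have := norm_iteratedFDerivWithin_mul_le (A := ℝ) (ha.contDiffOn (s := u)) hu'
    hu.uniqueDiffOn hxu hj'
  rw [iteratedFDerivWithin_of_isOpen j hu hxu] at this
  rw [← norm_le_zero_iff]
  refine this.trans (Finset.sum_nonpos fun i _ => ?_)
  rw [iteratedFDerivWithin_of_isOpen (j - i) hu hxu, H _ (by omega)]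
  simp

/-- Gluing of finitely many smooth functions on closed sets, whose derivatives agree on the
pairwise intersections. -/
theorem contDiffOn_iUnion_of_iteratedFDeriv_eq {ι : Type*} [Finite ι] {S : ι → Set E}
    (hS : ∀ i, IsClosed (S i)) {g : ι → E → F} {f : E → F} {k : ℕ}
    (hg : ∀ i, ContDiff ℝ k (g i)) (hfg : ∀ i, ∀ x ∈ S i, f x = g i x)
    (H : ∀ i i', ∀ x ∈ S i, x ∈ S i' → ∀ j ≤ k,
      iteratedFDeriv ℝ j (g i) x = iteratedFDeriv ℝ j (g i') x) :
    ContDiffOn ℝ k f (⋃ i, S i) := by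
  classical
  -- The candidate Taylor series of `f`: the choice of a piece through `x` is immaterial up to order
  -- `k`, by `H`.
  let p : E → FormalMultilinearSeries ℝ E F := fun x =>
    if h : ∃ i, x ∈ S i then ftaylorSeries ℝ (g h.choose) x else 0
  have hp : ∀ i, ∀ x ∈ S i, ∀ j ≤ k, p x j = iteratedFDeriv ℝ j (g i) x := by
    intro i x hx j hj
    have h : ∃ i, x ∈ S i := ⟨i, hx⟩
    simp only [p, h, dif_pos, ftaylorSeries]
    exact H _ _ x h.choose_spec hx j hj
  have hT : ∀ i, HasFTaylorSeriesUpToOn k f p (S i) := by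
    intro i
    have hi : HasFTaylorSeriesUpToOn k (g i) (ftaylorSeries ℝ (g i)) (S i) :=
      ((contDiff_iff_ftaylorSeries.1 (hg i)).hasFTaylorSeriesUpToOn (S i))
    refine ⟨fun x hx => ?_, fun j hj x hx => ?_, fun j hj => ?_⟩
    · rw [hp i x hx 0 (Nat.zero_le _), hfg i x hx]
      exact hi.zero_eq x hx
    · have hj' : j < k := by exact_mod_cast hj
      rw [hp i x hx _ hj']
      exact (hi.fderivWithin j hj x hx).congr (fun y hy => hp i y hy j hj'.le) (hp i x hx j hj'.le)
    · have hj' : j ≤ k := by exact_mod_cast hj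
      exact (hi.cont j hj).congr fun y hy => hp i y hy j hj'
  refine HasFTaylorSeriesUpToOn.contDiffOn (f' := p) ⟨fun x hx => ?_, fun j hj x hx => ?_,
    fun j hj => ?_⟩
  · obtain ⟨i, hi⟩ := Set.mem_iUnion.1 hx
    exact (hT i).zero_eq x hi
  · have key : ∀ i, HasFDerivWithinAt (p · j) (p x j.succ).curryLeft (S i) x := by
      intro i
      by_cases hxi : x ∈ S i
      · exact (hT i).fderivWithin j hj x hxi
      · exact .of_notMem_closure (by rwa [(hS i).closure_eq])
    -- The filter `nhdsWithin` of a finite union is the supremum of those of its members, so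
    -- differentiability within each `S i` suffices. Closedness makes it vacuous when `x ∉ S i`.
    simp only [hasFDerivWithinAt_iff_isLittleO, Asymptotics.isLittleO_iff, nhdsWithin_iUnion,
      Filter.eventually_iSup] at key ⊢
    exact fun c hc i => key i hc
  · exact (locallyFinite_of_finite S).continuousOn_iUnion hS fun i => (hT i).cont j hj

end Jets

/-! ### Smoothness on stars as agreement of jets -/

section Star

variable {m : ℕ} {K : SimplicialComplex ℝ (Fin m → ℝ)}

theorem extendZero_apply (f : K.space → ℝ) {x : Fin m → ℝ} (hx : x ∈ K.space) :
    extendZero K f x = f ⟨x, hx⟩ :=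
  Subtype.val_injective.extend_apply f 0 ⟨x, hx⟩

theorem IsPiece.extendZero_eq {f : K.space → ℝ} {σ : Finset (Fin m → ℝ)}
    {p : MvPolynomial (Fin m) ℝ} (h : IsPiece f σ p) (hσ : σ ∈ K.faces) {x : Fin m → ℝ}
    (hx : x ∈ convexHull ℝ (σ : Set (Fin m → ℝ))) : extendZero K f x = eval x p := by
  rw [extendZero_apply f (K.convexHull_subset_space hσ hx)]
  exact h _ hx

theorem isClosed_convexHull_finset (σ : Finset (Fin m → ℝ)) :
    IsClosed (convexHull ℝ (σ : Set (Fin m → ℝ))) :=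
  (σ.finite_toSet.isCompact_convexHull ℝ).isClosed

/-- A simplex with `m + 1` affinely independent vertices is a convex set with non-empty interior.
Hence a polynomial's derivatives, even at boundary points, can be read off from its values on the
simplex. -/
theorem uniqueDiffOn_convexHull {σ : Finset (Fin m → ℝ)} (hσ : σ ∈ facesDim K m) :
    UniqueDiffOn ℝ (convexHull ℝ (σ : Set (Fin m → ℝ))) := by
  refine uniqueDiffOn_convex (convex_convexHull ℝ _) ?_
  rw [interior_convexHull_nonempty_iff_affineSpan_eq_top]
  have := (K.indep hσ.1).affineSpan_eq_top_iff_card_eq_finrank_add_one.2 (by simp [hσ.2])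
  simpa using this

/-- Every face is contained in a full-dimensional face. -/
def IsCovered (K : SimplicialComplex ℝ (Fin m → ℝ)) : Prop :=
  ∀ F ∈ K.faces, ∃ σ ∈ facesDim K m, F ⊆ σ

theorem IsPure.isCovered (h : IsPure K) (hK : K.faces.Finite) : IsCovered K := by
  intro F hF
  obtain ⟨σ, hFσ, hσ⟩ := hK.exists_le_maximal hF
  refine ⟨σ, ⟨hσ.1, h σ ?_⟩, hFσ⟩
  exact SimplicialComplex.mem_facets.2 ⟨hσ.1, fun t ht hst => le_antisymm hst (hσ.2 ht hst)⟩

theorem IsCovered.exists_mem (h : IsCovered K) {x : Fin m → ℝ} (hx : x ∈ K.space) :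
    ∃ σ ∈ facesDim K m, x ∈ convexHull ℝ (σ : Set (Fin m → ℝ)) := by
  obtain ⟨F, hF, hx⟩ := SimplicialComplex.mem_space_iff.1 hx
  obtain ⟨σ, hσ, hFσ⟩ := h F hF
  exact ⟨σ, hσ, convexHull_mono (by exact_mod_cast hFσ) hx⟩

/-- A simplex containing `τ` lies in a full-dimensional one, which then also contains `τ`; so only
the domains of the polynomial pieces matter. -/
theorem IsCovered.starSpace_eq (h : IsCovered K) (τ : Finset (Fin m → ℝ)) :
    starSpace K τ = ⋃ σ : {σ // σ ∈ facesDim K m ∧ τ ⊆ σ},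
      convexHull ℝ (σ.1 : Set (Fin m → ℝ)) := by
  ext x
  simp only [starSpace, Set.mem_iUnion, Set.mem_ofPred_eq, Subtype.exists]
  constructor
  · rintro ⟨F, ⟨hF, hτ⟩, hx⟩
    obtain ⟨σ, hσ, hFσ⟩ := h F hF
    exact ⟨σ, ⟨hσ, hτ.trans hFσ⟩, convexHull_mono (by exact_mod_cast hFσ) hx⟩
  · rintro ⟨σ, ⟨hσ, hτ⟩, hx⟩
    exact ⟨σ, ⟨hσ.1, hτ⟩, hx⟩

/-- The star is a union of sets of unique differentiability, hence one itself. Along `τ` the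
derivatives of each piece therefore equal those of `f` within the star, whichever simplex the piece
lives on. -/
theorem derivsAgreeOn_of_contDiffOn (h : IsCovered K) {τ σ σ' : Finset (Fin m → ℝ)}
    (hσ : σ ∈ facesDim K m) (hσ' : σ' ∈ facesDim K m) (hτσ : τ ⊆ σ) (hτσ' : τ ⊆ σ')
    {f : K.space → ℝ} {k : ℕ} (hf : ContDiffOn ℝ k (extendZero K f) (starSpace K τ))
    {p q : MvPolynomial (Fin m) ℝ} (hp : IsPiece f σ p) (hq : IsPiece f σ' q) :
    DerivsAgreeOn k τ p q := by
  have hU : UniqueDiffOn ℝ (starSpace K τ) := by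
    rw [h.starSpace_eq]
    intro x hx
    obtain ⟨ρ, hρ⟩ := Set.mem_iUnion.1 hx
    exact (uniqueDiffOn_convexHull ρ.2.1 x hρ).mono (Set.subset_iUnion_of_subset ρ le_rfl)
  have key : ∀ ρ ∈ facesDim K m, τ ⊆ ρ → ∀ a : MvPolynomial (Fin m) ℝ, IsPiece f ρ a →
      ∀ j ≤ k, ∀ x ∈ convexHull ℝ (τ : Set (Fin m → ℝ)),
        iteratedFDeriv ℝ j (fun y : Fin m → ℝ => eval y a) x =
          iteratedFDerivWithin ℝ j (extendZero K f) (starSpace K τ) x := by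
    intro ρ hρ hτρ a ha j hj x hx
    have hxρ : x ∈ convexHull ℝ (ρ : Set (Fin m → ℝ)) :=
      convexHull_mono (by exact_mod_cast hτρ) hx
    have hsub : convexHull ℝ (ρ : Set (Fin m → ℝ)) ⊆ starSpace K τ := by
      rw [h.starSpace_eq]
      exact Set.subset_iUnion_of_subset ⟨ρ, hρ, hτρ⟩ le_rfl
    rw [← iteratedFDerivWithin_subset hsub (uniqueDiffOn_convexHull hρ) hU
      (hf.of_le (by exact_mod_cast hj)) hxρ,
      ← iteratedFDerivWithin_eq_iteratedFDeriv (uniqueDiffOn_convexHull hρ)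
        (contDiff_eval a _).contDiffAt hxρ]
    exact iteratedFDerivWithin_congr (fun y hy => (ha.extendZero_eq hρ.1 hy).symm) hxρ j
  intro j hj x hx
  rw [key σ hσ hτσ p hp j hj x hx, key σ' hσ' hτσ' q hq j hj x hx]

theorem contDiffOn_of_derivsAgreeOn (h : IsCovered K) (hK : K.faces.Finite)
    {τ : Finset (Fin m → ℝ)} (hτ : τ.card = m)
    {f : K.space → ℝ} {k : ℕ} {P : Finset (Fin m → ℝ) → MvPolynomial (Fin m) ℝ}
    (hP : ∀ σ ∈ facesDim K m, IsPiece f σ (P σ))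
    (H : ∀ σ ∈ facesDim K m, ∀ σ' ∈ facesDim K m, τ ⊆ σ → τ ⊆ σ' →
      DerivsAgreeOn k τ (P σ) (P σ')) :
    ContDiffOn ℝ k (extendZero K f) (starSpace K τ) := by
  rw [h.starSpace_eq]
  have : Finite {σ // σ ∈ facesDim K m ∧ τ ⊆ σ} :=
    (hK.subset fun σ (hσ : σ ∈ facesDim K m ∧ τ ⊆ σ) => hσ.1.1).to_subtype
  refine contDiffOn_iUnion_of_iteratedFDeriv_eq
    (S := fun σ : {σ // σ ∈ facesDim K m ∧ τ ⊆ σ} => convexHull ℝ (σ.1 : Set (Fin m → ℝ)))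
    (g := fun σ (y : Fin m → ℝ) => eval y (P σ.1)) (fun σ => isClosed_convexHull_finset σ.1) (fun σ => contDiff_eval _ _)
    (fun σ x hx => (hP σ.1 σ.2.1).extendZero_eq σ.2.1.1 hx) ?_
  rintro ⟨σ, hσ, hτσ⟩ ⟨σ', hσ', hτσ'⟩ x hx hx' j hj
  change iteratedFDeriv ℝ j (fun y : Fin m → ℝ => eval y (P σ)) x =
    iteratedFDeriv ℝ j (fun y : Fin m → ℝ => eval y (P σ')) x
  by_cases hne : σ = σ'
  · rw [hne]
  refine H σ hσ σ' hσ' hτσ hτσ' j hj x ?_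
  have hx'' := K.inter_subset_convexHull hσ.1 hσ'.1 ⟨hx, hx'⟩
  -- Two different `m`-faces share at most `m` vertices, and `τ` already supplies `m` of them.
  have hint : σ ∩ σ' = τ := by
    refine (Finset.eq_of_subset_of_card_le (Finset.subset_inter hτσ hτσ') ?_).symm
    have hlt : (σ ∩ σ').card < σ.card := by
      refine Finset.card_lt_card ⟨Finset.inter_subset_left, fun hsub => hne ?_⟩
      refine Finset.eq_of_subset_of_card_le (hsub.trans Finset.inter_subset_right) ?_
      rw [hσ.2, hσ'.2]
    have := hσ.2
    omega
  rwa [← hint, Finset.coe_inter]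

theorem IsCovered.continuous (h : IsCovered K) (hK : K.faces.Finite) {f : K.space → ℝ}
    {P : Finset (Fin m → ℝ) → MvPolynomial (Fin m) ℝ}
    (hP : ∀ σ ∈ facesDim K m, IsPiece f σ (P σ)) : Continuous f := by
  have : Finite (facesDim K m) := (hK.subset fun σ hσ => hσ.1).to_subtype
  let S : facesDim K m → Set K.space := fun σ =>
    Subtype.val ⁻¹' convexHull ℝ (σ.1 : Set (Fin m → ℝ))
  refine (locallyFinite_of_finite S).continuous ?_
    (fun σ => (isClosed_convexHull_finset σ.1).preimage continuous_subtype_val) ?_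
  · refine Set.eq_univ_of_forall fun x => ?_
    obtain ⟨σ, hσ, hx⟩ := h.exists_mem x.2
    exact Set.mem_iUnion.2 ⟨⟨σ, hσ⟩, hx⟩
  · intro σ
    have hc : Continuous fun x : K.space => eval x.1 (P σ.1) :=
      (contDiff_eval (P σ.1) 0).continuous.comp continuous_subtype_val
    exact hc.continuousOn.congr fun x hx => hP σ.1 σ.2 x hx

end Star

/-! ### Homogenization -/

section Homogenize

variable {n : ℕ}

theorem embed_apply_succ (x : Fin n → ℝ) (i : Fin n) : embed x i.succ = x i := rfl

theorem IsHomogeneous.eval_smul {σ : Type*} {P : MvPolynomial σ ℝ} {d : ℕ}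
    (hP : P.IsHomogeneous d) (t : ℝ) (x : σ → ℝ) : eval (t • x) P = t ^ d * eval x P := by
  rw [eval_eq, eval_eq, Finset.mul_sum]
  refine Finset.sum_congr rfl fun u hu => ?_
  have hd := hP.degree_eq_sum_deg_support hu
  simp only [Pi.smul_apply, smul_eq_mul, mul_pow, Finset.prod_mul_distrib,
    Finset.prod_pow_eq_pow_sum, ← hd]
  ring

theorem eval_dehomogenize (P : MvPolynomial (Fin (n + 1)) ℝ) (x : Fin n → ℝ) :
    eval x (dehomogenize P) = eval (embed x) P := by
  induction P using MvPolynomial.induction_on with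
  | C a => simp [dehomogenize]
  | add p q hp hq => simp [hp, hq]
  | mul_X p i hp =>
    rw [map_mul, map_mul, map_mul, hp, eval_X]
    congr 1
    refine Fin.cases ?_ (fun i => ?_) i <;> simp [dehomogenize, embed_apply_zero, embed_apply_succ]

theorem totalDegree_dehomogenize_le (P : MvPolynomial (Fin (n + 1)) ℝ) :
    (dehomogenize P).totalDegree ≤ P.totalDegree := by
  rw [dehomogenize, aeval_def, eval₂_eq]
  refine totalDegree_finsetSum_le fun u hu => (totalDegree_mul _ _).trans ?_
  rw [algebraMap_eq, totalDegree_C, zero_add]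
  refine (totalDegree_finsetProd _ _).trans (le_trans ?_ (le_totalDegree hu))
  refine Finset.sum_le_sum fun i _ => (totalDegree_pow _ _).trans ?_
  refine (Nat.mul_le_mul_left _ (?_ : _ ≤ 1)).trans_eq (mul_one _)
  refine Fin.cases ?_ (fun i => ?_) i <;> simp

/-- The homogenization of degree `d`, with homogenizing variable `x₀`, of a polynomial of total
degree at most `d`. -/
def homogenize (d : ℕ) : MvPolynomial (Fin n) ℝ →ₗ[ℝ] MvPolynomial (Fin (n + 1)) ℝ :=
  ∑ j ∈ Finset.range (d + 1), LinearMap.mulLeft ℝ (X 0 ^ (d - j)) ∘ₗ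
    (rename Fin.succ).toLinearMap ∘ₗ homogeneousComponent j

theorem homogenize_apply (d : ℕ) (p : MvPolynomial (Fin n) ℝ) :
    homogenize d p = ∑ j ∈ Finset.range (d + 1),
      X 0 ^ (d - j) * rename Fin.succ (homogeneousComponent j p) := by
  simp [homogenize]

theorem isHomogeneous_homogenize (d : ℕ) (p : MvPolynomial (Fin n) ℝ) :
    (homogenize d p).IsHomogeneous d := by
  rw [homogenize_apply]
  refine IsHomogeneous.sum _ _ _ fun j hj => ?_
  have := (isHomogeneous_X_pow (R := ℝ) (0 : Fin (n + 1)) (d - j)).mul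
    ((homogeneousComponent_isHomogeneous j p).rename_isHomogeneous (f := Fin.succ))
  rwa [Nat.sub_add_cancel (Nat.lt_succ_iff.1 (Finset.mem_range.1 hj))] at this

theorem sum_homogeneousComponent_of_le {d : ℕ} {p : MvPolynomial (Fin n) ℝ}
    (hp : p.totalDegree ≤ d) : ∑ j ∈ Finset.range (d + 1), homogeneousComponent j p = p := by
  conv_rhs => rw [← sum_homogeneousComponent p]
  refine (Finset.sum_subset (Finset.range_mono (by omega)) fun j _ hj => ?_).symm
  exact homogeneousComponent_eq_zero _ _ (by simpa using hj)

/-- Setting `x₀ = 1` adds the homogeneous components back up; the degree bound ensures that none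
above `d` was dropped. -/
theorem eval_embed_homogenize {d : ℕ} {p : MvPolynomial (Fin n) ℝ} (hp : p.totalDegree ≤ d)
    (y : Fin n → ℝ) : eval (embed y) (homogenize d p) = eval y p := by
  conv_rhs => rw [← sum_homogeneousComponent_of_le hp]
  rw [homogenize_apply, map_sum, map_sum]
  refine Finset.sum_congr rfl fun j _ => ?_
  have : (embed y : Fin (n + 1) → ℝ) ∘ Fin.succ = y := by
    ext i
    simp [embed_apply_succ]
  simp [eval_rename, this, embed_apply_zero]

theorem eval_smul_embed_homogenize {d : ℕ} {p : MvPolynomial (Fin n) ℝ} (hp : p.totalDegree ≤ d)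
    (t : ℝ) (y : Fin n → ℝ) :
    eval (t • embed y) (homogenize d p) = t ^ d * eval y p := by
  rw [IsHomogeneous.eval_smul (isHomogeneous_homogenize d p), eval_embed_homogenize hp]

end Homogenize

/-! ### Points of cones and derivatives along cones -/

section ConePoints

variable {n : ℕ}

theorem embed_mem_convexHull_coneFace {β : Finset (Fin n → ℝ)} {y : Fin n → ℝ}
    (hy : y ∈ convexHull ℝ (β : Set (Fin n → ℝ))) :
    embed y ∈ convexHull ℝ (coneFace β : Set (Fin (n + 1) → ℝ)) := by
  have : embed y ∈ convexHull ℝ (embed '' (β : Set (Fin n → ℝ))) := by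
    rw [convexHull_embed]
    exact ⟨y, hy, rfl⟩
  refine convexHull_mono ?_ this
  rintro _ ⟨z, hz, rfl⟩
  exact Finset.mem_cons_of_mem (Finset.mem_map_of_mem _ hz)

/-- Polar coordinates on a cone. The apex is included as `t = 0`, with an arbitrary `y`, whence the
need for `β` to be non-empty. -/
theorem exists_of_mem_convexHull_coneFace {β : Finset (Fin n → ℝ)} (hβ : β.Nonempty)
    {x : Fin (n + 1) → ℝ} (hx : x ∈ convexHull ℝ (coneFace β : Set (Fin (n + 1) → ℝ))) :
    ∃ y ∈ convexHull ℝ (β : Set (Fin n → ℝ)), ∃ t : ℝ, 0 ≤ t ∧ x = t • embed y := by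
  rcases exists_of_mem_convexHull subset_rfl hx with ⟨rfl, -⟩ | ⟨y, hy, t, ht, -, -, rfl⟩
  · obtain ⟨y, hy⟩ := hβ
    exact ⟨y, subset_convexHull ℝ _ hy, 0, le_rfl, by simp⟩
  · rw [base_coneFace] at hy
    exact ⟨y, hy, t, ht.le, rfl⟩

theorem contDiff_embed {k : WithTop ℕ∞} : ContDiff ℝ k (embed : (Fin n → ℝ) → Fin (n + 1) → ℝ) := by
  refine contDiff_pi.2 fun i => ?_
  refine Fin.cases ?_ (fun i => ?_) i
  · exact contDiff_const
  · exact contDiff_apply ℝ ℝ i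

theorem DerivsAgreeOn.dehomogenize {k : ℕ} {β : Finset (Fin n → ℝ)}
    {P Q : MvPolynomial (Fin (n + 1)) ℝ} (h : DerivsAgreeOn k (coneFace β) P Q) :
    DerivsAgreeOn k β (SuperSpline.dehomogenize P) (SuperSpline.dehomogenize Q) := by
  intro j hj x hx
  simp only [eval_dehomogenize]
  exact iteratedFDeriv_comp_congr (f := embed) (contDiff_eval P _).contDiffAt
    (contDiff_eval Q _).contDiffAt contDiff_embed.contDiffAt
    (fun i hi => h i hi _ (embed_mem_convexHull_coneFace hx)) hj

theorem derivsAgreeOn_zero_iff {m k : ℕ} {β : Finset (Fin m → ℝ)} {p : MvPolynomial (Fin m) ℝ} :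
    DerivsAgreeOn k β p 0 ↔ ∀ j ≤ k, ∀ x ∈ convexHull ℝ (β : Set (Fin m → ℝ)),
      iteratedFDeriv ℝ j (fun y : Fin m → ℝ => eval y p) x = 0 := by
  have : (fun y : Fin m → ℝ => eval y (0 : MvPolynomial (Fin m) ℝ)) = 0 := by
    ext
    simp
  simp only [DerivsAgreeOn, this, iteratedFDeriv_zero, Pi.zero_apply]

/-- Reduces agreement of jets to vanishing of jets, a property that survives multiplication by a
power of `x₀`. -/
theorem derivsAgreeOn_iff_sub {m k : ℕ} {β : Finset (Fin m → ℝ)}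
    {p q : MvPolynomial (Fin m) ℝ} : DerivsAgreeOn k β p q ↔ DerivsAgreeOn k β (p - q) 0 := by
  constructor
  · intro h
    have h' : DerivsAgreeOn k β (-q) (-q) := fun _ _ _ _ => rfl
    simpa [sub_eq_add_neg] using h.add h'
  · intro h
    have h' : DerivsAgreeOn k β q q := fun _ _ _ _ => rfl
    simpa using h.add h'

/-- If the derivatives of `p` vanish at `y`, then those of its homogenization vanish on the open
ray through `(1, y)`. -/
theorem iteratedFDeriv_homogenize_eq_zero {d k : ℕ} {p : MvPolynomial (Fin n) ℝ}
    (hp : p.totalDegree ≤ d) {y : Fin n → ℝ}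
    (h : ∀ j ≤ k, iteratedFDeriv ℝ j (fun y : Fin n → ℝ => eval y p) y = 0)
    {t : ℝ} (ht : 0 < t) {j : ℕ} (hj : j ≤ k) :
    iteratedFDeriv ℝ j (fun x : Fin (n + 1) → ℝ => eval x (homogenize d p)) (t • embed y) = 0 := by
  -- Radial projection to the hyperplane `x₀ = 1`, smooth where `x₀ ≠ 0`.
  let g : (Fin (n + 1) → ℝ) → Fin n → ℝ := fun x i => (x 0)⁻¹ * x i.succ
  have hpos : ∀ᶠ x in nhds (t • embed y : Fin (n + 1) → ℝ), 0 < x 0 := by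
    refine (continuous_apply (0 : Fin (n + 1))).continuousAt.eventually (lt_mem_nhds ?_)
    simpa [embed_apply_zero] using ht
  have hgx : g (t • embed y) = y := by
    ext i
    simp [g, embed_apply_zero, embed_apply_succ, ht.ne']
  have hg : ContDiffAt ℝ k g (t • embed y) := by
    refine contDiffAt_pi.2 fun i => ContDiffAt.mul ?_ (contDiff_apply ℝ ℝ i.succ).contDiffAt
    exact (contDiff_apply ℝ ℝ (0 : Fin (n + 1))).contDiffAt.inv hpos.self_of_nhds.ne'
  have heq : (fun x : Fin (n + 1) → ℝ => eval x (homogenize d p)) =ᶠ[nhds (t • embed y)]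
      fun x => x 0 ^ d * ((fun y : Fin n → ℝ => eval y p) ∘ g) x := by
    filter_upwards [hpos] with x hx
    have : x = x 0 • embed (g x) := by
      ext i
      refine Fin.cases ?_ (fun i => ?_) i <;>
        simp [embed_apply_zero, embed_apply_succ, g, hx.ne']
    conv_lhs => rw [this]
    exact eval_smul_embed_homogenize hp _ _
  rw [(heq.iteratedFDeriv ℝ j).self_of_nhds]
  have hp' : ContDiffAt ℝ k (fun y : Fin n → ℝ => eval y p) (g (t • embed y)) :=
    (contDiff_eval p _).contDiffAt
  refine iteratedFDeriv_mul_eq_zero (k := k) ((contDiff_apply ℝ ℝ (0 : Fin (n + 1))).pow d)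
    (hp'.comp _ hg) (fun i hi => ?_) hj
  -- The jet of `p` at `g (t • embed y) = y` is that of the zero function, so `p ∘ g` has the jet of
  -- `0 ∘ g`.
  rw [iteratedFDeriv_comp_congr hp' (h := fun _ => 0) contDiffAt_const hg ?_ hi]
  · change iteratedFDeriv ℝ i (0 : (Fin (n + 1) → ℝ) → ℝ) _ = 0
    simp
  · intro l hl
    change _ = iteratedFDeriv ℝ l (0 : (Fin n → ℝ) → ℝ) _
    rw [hgx, h l hl]
    simp

theorem DerivsAgreeOn.homogenize {d k : ℕ} {β : Finset (Fin n → ℝ)} (hβ : β.Nonempty)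
    {p q : MvPolynomial (Fin n) ℝ} (hp : p.totalDegree ≤ d) (hq : q.totalDegree ≤ d)
    (h : DerivsAgreeOn k β p q) :
    DerivsAgreeOn k (coneFace β) (SuperSpline.homogenize d p) (SuperSpline.homogenize d q) := by
  rw [derivsAgreeOn_iff_sub, derivsAgreeOn_zero_iff] at h
  rw [derivsAgreeOn_iff_sub, derivsAgreeOn_zero_iff, ← map_sub]
  intro j hj x hx
  obtain ⟨y, hy, t, ht, rfl⟩ := exists_of_mem_convexHull_coneFace hβ hx
  have hc : Continuous fun t : ℝ => iteratedFDeriv ℝ j (fun x : Fin (n + 1) → ℝ =>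
      eval x (SuperSpline.homogenize d (p - q))) (t • embed y) :=
    ((contDiff_eval _ j).continuous_iteratedFDeriv le_rfl).comp (by fun_prop)
  have hEq : Set.EqOn (fun t : ℝ => iteratedFDeriv ℝ j (fun x : Fin (n + 1) → ℝ =>
      eval x (SuperSpline.homogenize d (p - q))) (t • embed y)) 0 (Set.Ioi 0) := fun t ht =>
    iteratedFDeriv_homogenize_eq_zero ((totalDegree_sub _ _).trans (max_le hp hq))
      (fun i hi => h i hi y hy) ht hj
  -- The derivatives vanish for `t > 0`; by continuity in `t` they vanish at the apex `t = 0` as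
  -- well.
  refine hEq.closure hc continuous_const ?_
  rwa [closure_Ioi]

end ConePoints

/-! ### Faces of the cone -/

section ConeFaces

variable {n : ℕ} {Δ : SimplicialComplex ℝ (Fin n → ℝ)}

theorem card_coneFace (β : Finset (Fin n → ℝ)) : (coneFace β).card = β.card + 1 := by
  rw [coneFace, Finset.card_cons, Finset.card_map]

theorem coneFace_subset_coneFace {β γ : Finset (Fin n → ℝ)} :
    coneFace β ⊆ coneFace γ ↔ β ⊆ γ := by
  constructor
  · intro h
    simpa only [base_coneFace] using base_subset h
  · intro h
    exact Finset.cons_subset_cons.2 (Finset.map_subset_map.2 h)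

theorem coneFace_injective : Function.Injective (coneFace (n := n)) :=
  Function.LeftInverse.injective base_coneFace

theorem coneFace_mem_faces {β : Finset (Fin n → ℝ)} (hβ : β ∈ Δ.faces) :
    coneFace β ∈ (cone Δ).faces :=
  ⟨⟨0, Finset.mem_cons_self _ _⟩, β, Or.inr hβ, subset_rfl⟩

theorem embed_mem_space {x : Fin n → ℝ} (hx : x ∈ Δ.space) : embed x ∈ (cone Δ).space := by
  obtain ⟨β, hβ, hx⟩ := SimplicialComplex.mem_space_iff.1 hx
  exact SimplicialComplex.mem_space_iff.2
    ⟨_, coneFace_mem_faces hβ, embed_mem_convexHull_coneFace hx⟩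

theorem coneFace_mem_facesDim {k : ℕ} {σ : Finset (Fin n → ℝ)} (hσ : σ ∈ facesDim Δ k) :
    coneFace σ ∈ facesDim (cone Δ) (k + 1) :=
  ⟨coneFace_mem_faces hσ.1, by rw [card_coneFace, hσ.2]⟩

theorem exists_of_mem_facesDim_cone {G : Finset (Fin (n + 1) → ℝ)}
    (hG : G ∈ facesDim (cone Δ) (n + 1)) : ∃ σ ∈ facesDim Δ n, coneFace σ = G := by
  obtain ⟨⟨-, β, hβ, hGβ⟩, hcard⟩ := hG
  have h1 := Finset.card_le_card hGβ
  rw [card_coneFace, hcard] at h1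
  rcases hβ with rfl | hβ
  · simp at h1
  -- Affine independence in `ℝ^n`; together with `h1` it leaves no room between `G` and `coneFace
  -- β`.
  have h2 : β.card ≤ n + 1 := by
    simpa using (Δ.indep hβ).card_le_finrank_succ.trans
      (Nat.succ_le_succ (Submodule.finrank_le _))
  have h3 : β.card = n + 1 := by omega
  exact ⟨β, ⟨hβ, h3⟩, (Finset.eq_of_subset_of_card_le hGβ
    (by rw [card_coneFace, hcard, h3])).symm⟩

theorem coneFace_mem_interiorFacets {τ : Finset (Fin n → ℝ)} (hτ : τ ∈ interiorFacets Δ) :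
    coneFace τ ∈ interiorFacets (cone Δ) := by
  obtain ⟨h, hc, σ, hσ, σ', hσ', hne, hs, hs'⟩ := hτ
  exact ⟨coneFace_mem_faces h, by rw [card_coneFace, hc], _, coneFace_mem_facesDim hσ, _,
    coneFace_mem_facesDim hσ', coneFace_injective.ne hne, coneFace_subset_coneFace.2 hs,
    coneFace_subset_coneFace.2 hs'⟩

theorem coneFace_base {G : Finset (Fin (n + 1) → ℝ)} {β : Finset (Fin n → ℝ)}
    (hG : G ⊆ coneFace β) (h0 : 0 ∈ G) : coneFace (base G) = G := by
  ext x
  constructor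
  · intro hx
    rcases Finset.mem_cons.1 hx with rfl | hx
    · exact h0
    · obtain ⟨y, hy, rfl⟩ := Finset.mem_map.1 hx
      exact mem_base.1 hy
  · intro hx
    rcases eq_zero_or_mem_base hG hx with rfl | ⟨y, hy, rfl⟩
    · exact Finset.mem_cons_self _ _
    · exact Finset.mem_cons_of_mem (Finset.mem_map_of_mem _ hy)

theorem exists_of_mem_interiorFacets_cone (hn : 0 < n) {G : Finset (Fin (n + 1) → ℝ)}
    (hG : G ∈ interiorFacets (cone Δ)) : ∃ τ ∈ interiorFacets Δ, coneFace τ = G := by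
  obtain ⟨-, hc, _, hS, _, hS', hne, hs, hs'⟩ := hG
  obtain ⟨σ, hσ, rfl⟩ := exists_of_mem_facesDim_cone hS
  obtain ⟨σ', hσ', rfl⟩ := exists_of_mem_facesDim_cone hS'
  have h0 : 0 ∈ G := by
    -- Without the origin, the `n + 1` vertices of `G` all have height one, so `G` is the embedded
    -- copy of a single `n`-face and cannot lie in the cones over two different ones.
    by_contra h0
    have key : ∀ ρ ∈ facesDim Δ n, G ⊆ coneFace ρ → base G = ρ := by
      intro ρ hρ hGρ
      have hsub : G ⊆ (base G).map embed := by
        intro x hx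
        rcases eq_zero_or_mem_base hGρ hx with rfl | ⟨y, hy, rfl⟩
        · exact absurd hx h0
        · exact Finset.mem_map_of_mem _ hy
      have := Finset.card_le_card hsub
      rw [Finset.card_map] at this
      refine Finset.eq_of_subset_of_card_le (base_subset hGρ) ?_
      rw [hρ.2]
      omega
    exact hne (by rw [← key σ hσ hs, ← key σ' hσ' hs'])
  have hG := coneFace_base hs h0
  have hcard : (base G).card = n := by
    have := card_coneFace (base G)
    rw [hG, hc] at this
    omega
  -- Since `n > 0`, the `n`-element set `base G` is non-empty and hence a face.
  refine ⟨base G, ⟨Δ.down_closed hσ.1 (base_subset hs) (Finset.card_pos.1 (by omega)), hcard,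
    σ, hσ, σ', hσ', fun h => hne (by rw [h]), base_subset hs, base_subset hs'⟩, hG⟩

theorem IsCovered.cone (h : IsCovered Δ) (hne : Δ.faces.Nonempty) :
    IsCovered (SuperSpline.cone Δ) := by
  rintro F ⟨-, β, hβ, hFβ⟩
  rcases hβ with rfl | hβ
  -- Here `F` is the origin alone, and the cone over any `n`-face contains it.
  · obtain ⟨β, hβ⟩ := hne
    obtain ⟨σ, hσ, -⟩ := h β hβ
    exact ⟨_, coneFace_mem_facesDim hσ,
      hFβ.trans (coneFace_subset_coneFace.2 (Finset.empty_subset _))⟩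
  · obtain ⟨σ, hσ, hβσ⟩ := h β hβ
    exact ⟨_, coneFace_mem_facesDim hσ, hFβ.trans (coneFace_subset_coneFace.2 hβσ)⟩

theorem finite_faces_cone (h : Δ.faces.Finite) : (cone Δ).faces.Finite := by
  refine ((h.insert ∅).biUnion fun β _ => (coneFace β).powerset.finite_toSet).subset ?_
  rintro F ⟨-, β, hβ, hF⟩
  exact Set.mem_biUnion hβ (by simpa using hF)

theorem embed_mem_starSpace {τ : Finset (Fin n → ℝ)} {x : Fin n → ℝ}
    (hx : x ∈ starSpace Δ τ) : embed x ∈ starSpace (cone Δ) (coneFace τ) := by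
  simp only [starSpace, Set.mem_iUnion, Set.mem_ofPred_eq, exists_prop] at hx ⊢
  obtain ⟨σ, ⟨hσ, hτ⟩, hx⟩ := hx
  exact ⟨_, ⟨coneFace_mem_faces hσ, coneFace_subset_coneFace.2 hτ⟩,
    embed_mem_convexHull_coneFace hx⟩

/-- Restriction of functions on the cone to the hyperplane `x₀ = 1`. -/
def restrictCone (Δ : SimplicialComplex ℝ (Fin n → ℝ)) :
    ((cone Δ).space → ℝ) →ₗ[ℝ] (Δ.space → ℝ) :=
  LinearMap.funLeft ℝ ℝ fun x => ⟨embed x.1, embed_mem_space x.2⟩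

theorem restrictCone_apply (F : (cone Δ).space → ℝ) (x : Δ.space) :
    restrictCone Δ F x = F ⟨embed x.1, embed_mem_space x.2⟩ := rfl

theorem IsPiece.restrictCone {F : (cone Δ).space → ℝ} {σ : Finset (Fin n → ℝ)}
    {P : MvPolynomial (Fin (n + 1)) ℝ} (h : IsPiece F (coneFace σ) P) :
    IsPiece (SuperSpline.restrictCone Δ F) σ (dehomogenize P) := by
  intro x hx
  rw [restrictCone_apply, eval_dehomogenize]
  exact h _ (embed_mem_convexHull_coneFace hx)

end ConeFaces

/-! ### Dehomogenization of splines -/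

section Splines

variable {n i d : ℕ} {Δ : SimplicialComplex ℝ (Fin n → ℝ)} {r s : Finset (Fin n → ℝ) → ℕ}

/-- No jets are needed for smoothness in this direction: `embed` is smooth and maps the star of `τ`
into the star of its cone. -/
theorem restrictCone_mem {F : (cone Δ).space → ℝ}
    (hF : F ∈ supersplinesHomogeneous (cone Δ) (coneOrder r) (coneFace '' facesDim Δ i)
      (coneOrder s) d) :
    restrictCone Δ F ∈ supersplinesLE Δ r (facesDim Δ i) s d := by
  obtain ⟨hcont, hsmooth, P, hP, hPs⟩ := hF
  refine ⟨?_, fun τ hτ => ?_, fun σ => dehomogenize (P (coneFace σ)), fun σ hσ => ⟨?_, ?_⟩, ?_⟩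
  · refine hcont.comp (Continuous.subtype_mk ?_ _)
    exact (contDiff_embed (k := 0)).continuous.comp continuous_subtype_val
  · have h := hsmooth _ (coneFace_mem_interiorFacets hτ)
    rw [coneOrder_coneFace] at h
    refine (h.comp contDiff_embed.contDiffOn fun x hx => embed_mem_starSpace hx).congr ?_
    intro x hx
    have hxs : x ∈ Δ.space := by
      simp only [starSpace, Set.mem_iUnion, Set.mem_ofPred_eq, exists_prop] at hx
      obtain ⟨σ, ⟨hσ, -⟩, hx⟩ := hx
      exact Δ.convexHull_subset_space hσ hx
    rw [extendZero_apply _ hxs, Function.comp_apply, extendZero_apply _ (embed_mem_space hxs),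
      restrictCone_apply]
  · rw [mem_restrictTotalDegree]
    have := (hP _ (coneFace_mem_facesDim hσ)).1
    rw [mem_homogeneousSubmodule] at this
    exact (totalDegree_dehomogenize_le _).trans this.totalDegree_le
  · exact (hP _ (coneFace_mem_facesDim hσ)).2.restrictCone
  · intro β hβ σ hσ σ' hσ' h h'
    have := hPs _ (Set.mem_image_of_mem _ hβ) _ (coneFace_mem_facesDim hσ) _
      (coneFace_mem_facesDim hσ') (coneFace_subset_coneFace.2 h) (coneFace_subset_coneFace.2 h')
    rw [coneOrder_coneFace] at this
    exact this.dehomogenize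

theorem eq_zero_of_restrictCone_eq_zero (hΔ : IsCovered Δ) (hne : Δ.faces.Nonempty)
    {F : (cone Δ).space → ℝ}
    (hF : F ∈ supersplinesHomogeneous (cone Δ) (coneOrder r) (coneFace '' facesDim Δ i)
      (coneOrder s) d) (h0 : restrictCone Δ F = 0) : F = 0 := by
  obtain ⟨-, -, P, hP, -⟩ := hF
  ext x
  obtain ⟨_, hG, hx⟩ := (hΔ.cone hne).exists_mem x.2
  obtain ⟨σ, hσ, rfl⟩ := exists_of_mem_facesDim_cone hG
  obtain ⟨y, hy, t, -, hxt⟩ :=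
    exists_of_mem_convexHull_coneFace (Δ.nonempty_of_mem_faces hσ.1) hx
  obtain ⟨hPd, hPσ⟩ := hP _ hG
  have hys := Δ.convexHull_subset_space hσ.1 hy
  have hPy : eval (embed y) (P (coneFace σ)) = 0 :=
    (hPσ ⟨embed y, embed_mem_space hys⟩ (embed_mem_convexHull_coneFace hy)).symm.trans
      (congrFun h0 ⟨y, hys⟩)
  rw [hPσ x hx, hxt, IsHomogeneous.eval_smul ((mem_homogeneousSubmodule _ _).1 hPd), hPy]
  simp

/-- A piecewise constant continuous function on a connected complex is constant. -/
theorem eq_of_pieces_totalDegree_zero (hΔ : IsCovered Δ) (hfin : Δ.faces.Finite)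
    (hconn : IsConnected Δ.space) {f : Δ.space → ℝ} (hf : Continuous f)
    {P : Finset (Fin n → ℝ) → MvPolynomial (Fin n) ℝ}
    (hP : ∀ σ ∈ facesDim Δ n, (P σ).totalDegree ≤ 0 ∧ IsPiece f σ (P σ)) (x y : Δ.space) :
    f x = f y := by
  have : PreconnectedSpace Δ.space := isPreconnected_iff_preconnectedSpace.1 hconn.isPreconnected
  have hfinite : (Set.range f).Finite := by
    refine ((hfin.subset fun σ (hσ : σ ∈ facesDim Δ n) => hσ.1).image
      fun σ => coeff 0 (P σ)).subset ?_
    rintro _ ⟨z, rfl⟩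
    obtain ⟨σ, hσ, hz⟩ := hΔ.exists_mem z.2
    refine ⟨σ, hσ, ?_⟩
    obtain ⟨hd, hp⟩ := hP σ hσ
    rw [hp z hz, totalDegree_eq_zero_iff_eq_C.1 (Nat.le_zero.1 hd)]
    simp
  have hsub : (Set.range f).Subsingleton := by
    by_contra h
    -- The values of `f` lie among the finitely many constant terms of the pieces, whereas a
    -- connected subset of `ℝ` with two points is infinite.
    exact (isPreconnected_range hf).infinite_of_nontrivial (Set.not_subsingleton_iff.1 h) hfinite
  exact hsub ⟨x, rfl⟩ ⟨y, rfl⟩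

/-- Homogeneous extensions of the pieces of `f` glue to a function on the cone. -/
theorem exists_isPiece_homogenize (hΔ : IsCovered Δ) (hne : Δ.faces.Nonempty) {f : Δ.space → ℝ}
    {P : Finset (Fin n → ℝ) → MvPolynomial (Fin n) ℝ}
    (hP : ∀ σ ∈ facesDim Δ n, (P σ).totalDegree ≤ d ∧ IsPiece f σ (P σ))
    (hconst : d = 0 → ∀ x y, f x = f y) :
    ∃ F : (cone Δ).space → ℝ,
      ∀ σ ∈ facesDim Δ n, IsPiece F (coneFace σ) (homogenize d (P σ)) := by
  have hex : ∀ x : (cone Δ).space, ∃ σ ∈ facesDim Δ n,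
      x.1 ∈ convexHull ℝ (coneFace σ : Set (Fin (n + 1) → ℝ)) := by
    intro x
    obtain ⟨_, hG, hx⟩ := (hΔ.cone hne).exists_mem x.2
    obtain ⟨σ, hσ, rfl⟩ := exists_of_mem_facesDim_cone hG
    exact ⟨σ, hσ, hx⟩
  -- An arbitrary choice of a cone through each point; the value does not depend on it.
  choose ρ hρ hxρ using hex
  refine ⟨fun x => eval x.1 (homogenize d (P (ρ x))), fun σ hσ x hx => ?_⟩
  obtain ⟨y, hy, t, ht, hxy⟩ :=
    exists_of_mem_convexHull_coneFace (Δ.nonempty_of_mem_faces hσ.1) hx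
  obtain ⟨z, hz, u, -, hxz⟩ :=
    exists_of_mem_convexHull_coneFace (Δ.nonempty_of_mem_faces (hρ x).1) (hxρ x)
  have htu : t = u := by
    simpa [embed_apply_zero] using congrFun (hxy.symm.trans hxz) 0
  subst htu
  have hys := Δ.convexHull_subset_space hσ.1 hy
  have hzs := Δ.convexHull_subset_space (hρ x).1 hz
  have h1 : eval x.1 (homogenize d (P σ)) = t ^ d * f ⟨y, hys⟩ := by
    rw [hxy, eval_smul_embed_homogenize (hP σ hσ).1, (hP σ hσ).2 ⟨y, hys⟩ hy]
  have h2 : eval x.1 (homogenize d (P (ρ x))) = t ^ d * f ⟨z, hzs⟩ := by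
    rw [hxz, eval_smul_embed_homogenize (hP _ (hρ x)).1, (hP _ (hρ x)).2 ⟨z, hzs⟩ hz]
  change eval x.1 (homogenize d (P (ρ x))) = _
  rw [h1, h2]
  -- At the apex `y` and `z` may differ: for `d > 0` the factor `0 ^ d` kills both sides, and `d =
  -- 0` is where `hconst` enters. Off the apex `y = z`.
  rcases ht.eq_or_lt with rfl | ht
  · rcases Nat.eq_zero_or_pos d with hd | hd
    · rw [hconst hd ⟨y, hys⟩ ⟨z, hzs⟩]
    · simp [hd.ne']
  · have hyz : y = z := embed.injective (smul_right_injective _ ht.ne' (hxy.symm.trans hxz))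
    subst hyz
    rfl

theorem exists_restrictCone_eq (hn : 0 < n) (hΔ : IsCovered Δ) (hfin : Δ.faces.Finite)
    (hne : Δ.faces.Nonempty) (hd : d = 0 → IsConnected Δ.space) {f : Δ.space → ℝ}
    (hf : f ∈ supersplinesLE Δ r (facesDim Δ i) s d) :
    ∃ F ∈ supersplinesHomogeneous (cone Δ) (coneOrder r) (coneFace '' facesDim Δ i)
      (coneOrder s) d, restrictCone Δ F = f := by
  obtain ⟨hcont, hsmooth, P, hP, hPs⟩ := hf
  simp only [mem_restrictTotalDegree] at hP
  obtain ⟨F, hF⟩ := exists_isPiece_homogenize hΔ hne hP fun h0 =>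
    eq_of_pieces_totalDegree_zero hΔ hfin (hd h0) hcont fun σ hσ => by
      simpa only [h0] using hP σ hσ
  have hF' : ∀ G ∈ facesDim (cone Δ) (n + 1), IsPiece F G (homogenize d (P (base G))) := by
    intro G hG
    obtain ⟨σ, hσ, rfl⟩ := exists_of_mem_facesDim_cone hG
    rw [base_coneFace]
    exact hF σ hσ
  -- Stated for arbitrary `β` and `k` to serve both interior facets with order `r` and faces in
  -- `Δ_i` with order `s`.
  have hagree : ∀ β ∈ Δ.faces, ∀ k : ℕ,
      (∀ σ ∈ facesDim Δ n, ∀ σ' ∈ facesDim Δ n, β ⊆ σ → β ⊆ σ' →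
        DerivsAgreeOn k β (P σ) (P σ')) →
      ∀ G ∈ facesDim (cone Δ) (n + 1), ∀ G' ∈ facesDim (cone Δ) (n + 1), coneFace β ⊆ G →
        coneFace β ⊆ G' → DerivsAgreeOn k (coneFace β) (homogenize d (P (base G)))
          (homogenize d (P (base G'))) := by
    intro β hβ k h G hG G' hG' hβG hβG'
    obtain ⟨σ, hσ, rfl⟩ := exists_of_mem_facesDim_cone hG
    obtain ⟨σ', hσ', rfl⟩ := exists_of_mem_facesDim_cone hG'
    rw [base_coneFace, base_coneFace]
    exact (h σ hσ σ' hσ' (coneFace_subset_coneFace.1 hβG)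
      (coneFace_subset_coneFace.1 hβG')).homogenize (Δ.nonempty_of_mem_faces hβ)
      (hP σ hσ).1 (hP σ' hσ').1
  have hcov := hΔ.cone hne
  have hcfin := finite_faces_cone hfin
  refine ⟨F, ⟨hcov.continuous hcfin hF', fun G hG => ?_, fun G => homogenize d (P (base G)),
    fun G hG => ⟨?_, hF' G hG⟩, ?_⟩, ?_⟩
  · obtain ⟨τ, hτ, rfl⟩ := exists_of_mem_interiorFacets_cone hn hG
    rw [coneOrder_coneFace]
    refine contDiffOn_of_derivsAgreeOn hcov hcfin (by rw [card_coneFace, hτ.2.1])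
      (P := fun G => homogenize d (P (base G))) hF' ?_
    exact hagree τ hτ.1 (r τ) fun σ hσ σ' hσ' h h' =>
      derivsAgreeOn_of_contDiffOn hΔ hσ hσ' h h' (hsmooth τ hτ) (hP σ hσ).2 (hP σ' hσ').2
  · exact (mem_homogeneousSubmodule _ _).2 (isHomogeneous_homogenize _ _)
  · rintro _ ⟨β, hβ, rfl⟩
    rw [coneOrder_coneFace]
    exact hagree β hβ.1 (s β) (hPs β hβ)
  · ext x
    obtain ⟨σ, hσ, hx⟩ := hΔ.exists_mem x.2
    rw [restrictCone_apply, hF σ hσ _ (embed_mem_convexHull_coneFace hx), (hP σ hσ).2 x hx]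
    exact eval_embed_homogenize (hP σ hσ).1 _

end Splines
end SuperSpline
end

open SuperSpline in
theorem proposition3p5 {n i : ℕ} (hi : i + 2 ≤ n)
    (Δ : Geometry.SimplicialComplex ℝ (Fin n → ℝ))
    (hfinite : Δ.faces.Finite) (hnonempty : Δ.faces.Nonempty)
    (hpure : IsPure Δ) (hhereditary : IsHereditary Δ)
    (d : ℕ) (hd : d = 0 → IsConnected Δ.space)
    (r s : Finset (Fin n → ℝ) → ℕ) :
    ∃ φ : supersplinesHomogeneous (cone Δ) (coneOrder r) (coneFace '' facesDim Δ i)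
          (coneOrder s) d ≃ₗ[ℝ] supersplinesLE Δ r (facesDim Δ i) s d,
      ∀ F : supersplinesHomogeneous (cone Δ) (coneOrder r) (coneFace '' facesDim Δ i)
          (coneOrder s) d,
        ∀ σ ∈ facesDim Δ n, ∀ P : MvPolynomial (Fin (n + 1)) ℝ,
          IsPiece F.1 (coneFace σ) P → IsPiece (φ F).1 σ (dehomogenize P) := by
  have hΔ := hpure.isCovered hfinite
  refine ⟨LinearEquiv.ofBijective ((restrictCone Δ).restrict fun F hF => restrictCone_mem hF)
    ⟨?_, ?_⟩, fun F σ _ P hP => hP.restrictCone⟩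
  · rw [injective_iff_map_eq_zero]
    intro F hF
    exact Subtype.ext (eq_zero_of_restrictCone_eq_zero hΔ hnonempty F.2 (congrArg Subtype.val hF))
  · intro f
    obtain ⟨F, hF, hFf⟩ := exists_restrictCone_eq (by omega) hΔ hfinite hnonempty hd f.2
    exact ⟨⟨F, hF⟩, Subtype.ext hFf⟩
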